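/- Let $k$ be a field of characteristic zero. A $k$-subspace $M$ of a commutative $k$-algebra $R$ is called a Mathieu subspace of $R$ if for every $a\in R$ with $a^m\in M$ for all $m\ge 1$ and every $b\in R$, there is an $N\in\mathbb{N}$ such that $ba^m\in M$ for all $m\ge N$. For a $k$-derivation $D=p\,\partial_x+q\,\partial_y$ of $k[x,y]$ (with $p,q\in k[x,y]$), put $\operatorname{div}D=\partial_x p+\partial_y q$ and $\operatorname{Im}D=D(k[x,y])$. Then the following two statements are equivalent: (1) for every $k$-derivation $D$ of $k[x,y]$ with $\operatorname{div}D=0$ and $1\in\operatorname{Im}D$, the image $\operatorname{Im}D$ is a Mathieu subspace of $k[x,y]$; (2) the two-dimensional Jacobian conjecture over $k$ holds: every polynomial map $F=(f,g)\in k[x,y]^2$ whose Jacobian determinant $f_xg_y-f_yg_x$ is a nonzero constant in $k$ has a two-sided inverse (under composition) that is a polynomial map over $k$. Moreover, for each $k$-derivation $D$ of $k[x,y]$ with $\operatorname{div}D=0$ and $1\in\operatorname{Im}D$, the image $\operatorname{Im}D$ is a Mathieu subspace of $k[x,y]$ if and only if $D$ is surjective; so in (1) "$\operatorname{Im}D$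 is a Mathieu subspace of $k[x,y]$" may be replaced by "$D$ is surjective". -/

import Mathlib

open MvPolynomial

/-- A `k`-subspace `M` of a commutative `k`-algebra `R` is a Mathieu subspace of `R` if, whenever
`a ^ m ∈ M` for all `m ≥ 1`, for every `b ∈ R` one has `b * a ^ m ∈ M` for all large `m`. -/
def IsMathieuSubspace {k R : Type*} [Field k] [CommRing R] [Algebra k R]
    (M : Submodule k R) : Prop :=
  ∀ a : R, (∀ m : ℕ, 1 ≤ m → a ^ m ∈ M) →
    ∀ b : R, ∃ N : ℕ, ∀ m : ℕ, N ≤ m → b * a ^ m ∈ M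

/-- The image of a `k`-derivation of a `k`-algebra `R`, as a `k`-subspace of `R`. -/
def derivationImage {k R : Type*} [Field k] [CommRing R] [Algebra k R]
    (D : Derivation k R R) : Submodule k R :=
  LinearMap.range (D : R →ₗ[k] R)

/-- The divergence `∂ₓ p + ∂_y q` of a `k`-derivation `D = p ∂ₓ + q ∂_y` of `k[x, y]`, where
`x = X 0`, `y = X 1`, and hence `p = D x`, `q = D y`. -/
noncomputable def divergence {k : Type*} [Field k]
    (D : Derivation k (MvPolynomial (Fin 2) k) (MvPolynomial (Fin 2) k)) :
    MvPolynomial (Fin 2) k :=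
  pderiv 0 (D (X 0)) + pderiv 1 (D (X 1))

/-- The Jacobian matrix `(∂ F i / ∂ x j)` of a polynomial map `F = (F 0, F 1)` of the plane. -/
noncomputable def jacobianMatrix {k : Type*} [Field k] (F : Fin 2 → MvPolynomial (Fin 2) k) :
    Matrix (Fin 2) (Fin 2) (MvPolynomial (Fin 2) k) :=
  Matrix.of fun i j => pderiv j (F i)

/-- The polynomial map `F` has a two-sided inverse `G` that is again a polynomial map over `k`:
both `F ∘ G` and `G ∘ F` are the identity map `(x, y)`. Here `bind₁ G (F i)` is the polynomial
`F i` with `G` substituted for the variables. -/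
def IsInvertiblePolynomialMap {k : Type*} [Field k]
    (F : Fin 2 → MvPolynomial (Fin 2) k) : Prop :=
  ∃ G : Fin 2 → MvPolynomial (Fin 2) k,
    (∀ i, bind₁ G (F i) = X i) ∧ (∀ i, bind₁ F (G i) = X i)

/-- The two-dimensional Jacobian conjecture over `k`: every polynomial map of the plane over `k`
whose Jacobian determinant is a nonzero constant is invertible. -/
def JacobianConjectureTwo (k : Type*) [Field k] : Prop :=
  ∀ F : Fin 2 → MvPolynomial (Fin 2) k,
    (∃ c : k, c ≠ 0 ∧ (jacobianMatrix F).det = C c) → IsInvertiblePolynomialMap F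

/-!
A subspace containing `1` is a Mathieu subspace only if it is everything (take `a = 1`), so the
content is that the Jacobian conjecture in the plane is equivalent to the surjectivity of every
divergence-free derivation `D` of `k[x, y]` having a slice, i.e. an `s` with `D s = 1`. By the
Poincaré lemma such a `D` is a Hamiltonian derivation `h ↦ f_x h_y - f_y h_x`, so the slice makes
`(f, s)` a Jacobian pair. If the pair is a coordinate system, then `D` is `∂ / ∂s` and is
surjective.

Conversely, suppose that `D` is surjective. It then acts surjectively on the functions `A` on the
generic fibre of `f`, a normal affine curve over `K = k(f)`, and is locally nilpotent there
(`locallyNilpotent_of_surjective_derivation`). Let `v` be the valuation of the function field at a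
point. The logarithmic derivatives `D c / c` of all `c` with `v c ≠ 1` have one and the same value,
which bounds that of all others (`logDeriv_le_of_valuation_ne_one`). If it is nonzero, this value is
never attained by a derivative (`valuation_apply_ne_logDeriv`): an exact differential has no simple
pole. This has two consequences.

* `A` is integral over `K[s]`. Otherwise there is a point at a finite value of `s` whose ideal
  generates the unit ideal of `A`. Arbitrary polar parts at that point are then available in `A`, in
  particular one whose differential has a simple pole, against the surjectivity of `D`
  (`isIntegral_of_surjective_derivation`).
* At each pole of `s` the derivation `D` lowers the order of a pole by at least that of `s`. As
  elements of `A` have poles only at those of `s`, iterated derivatives are eventually constant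
  (`iterate_derivation_eq_zero_of_isIntegral`).

Applied to both members of a Jacobian pair, this gives two commuting locally nilpotent derivations
`∂ / ∂s` and `-∂ / ∂f` of `k[x, y]` with common kernel `k`, and taking antiderivatives shows that
`k[x, y] = k[f, s]` (`surjective_bind₁_of_locallyNilpotent`).
-/

/-! ### Derivations of a field and discrete valuations -/

open WithZero in
theorem le_exp_neg_one_of_lt_one {x : ℤᵐ⁰} (hx : x < 1) : x ≤ exp (-1 : ℤ) := by
  rcases eq_or_ne x 0 with rfl | h0
  · exact zero_le
  · rw [← exp_log h0] at hx ⊢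
    rw [← exp_zero, exp_lt_exp] at hx
    rw [exp_le_exp]
    omega

section

variable {K L : Type*} [Field K] [CharZero K] [Field L] [Algebra K L]
  (v : Valuation L (WithZero (Multiplicative ℤ))) (D : Derivation K L L)

theorem valuation_intCast_eq_one (hK : ∀ a : K, a ≠ 0 → v (algebraMap K L a) = 1)
    {n : ℤ} (hn : n ≠ 0) : v (n : L) = 1 := by
  rw [← map_intCast (algebraMap K L)]
  exact hK _ (Int.cast_ne_zero.mpr hn)

omit [CharZero K] in
theorem Derivation.zpow_mul_zpow_div {a b : L} (ha : a ≠ 0) (hb : b ≠ 0) (m n : ℤ) :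
    D (a ^ m * b ^ n) / (a ^ m * b ^ n) = m * (D a / a) + n * (D b / b) := by
  have h1 : ∀ {x : L}, x ≠ 0 → ∀ i : ℤ, D (x ^ i) = x ^ i * (i * (D x / x)) := by
    intro x hx i
    rw [Derivation.leibniz_zpow, zpow_sub_one₀ hx, zsmul_eq_mul, smul_eq_mul]
    field_simp
  rw [Derivation.leibniz, h1 ha, h1 hb, smul_eq_mul, smul_eq_mul]
  have := zpow_ne_zero m ha
  have := zpow_ne_zero n hb
  field_simp
  ring

open WithZero in
/-- If the logarithmic derivative of `c` had strictly larger value than that of `φ`, then a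
monomial `w` in `c` and `φ` of value `1` would have the same logarithmic derivative as `c` up to
units, and for a polynomial `h` over the constants with `v (h w) < 1` the element `h w` would have
a logarithmic derivative of even larger value. -/
theorem exists_logDeriv_exp_mul_le (hK : ∀ a : K, a ≠ 0 → v (algebraMap K L a) = 1)
    (hres : ∀ u : L, v u = 1 → ∃ h : Polynomial K,
      v (Polynomial.aeval u h) < 1 ∧ v (Polynomial.aeval u h.derivative) = 1)
    {φ c : L} (hφ : φ ≠ 0) (hφ1 : v φ ≠ 1) (hc : c ≠ 0) (hlt : v (D φ / φ) < v (D c / c)) :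
    ∃ c' : L, c' ≠ 0 ∧ exp (1 : ℤ) * v (D c / c) ≤ v (D c' / c') := by
  obtain ⟨e, he⟩ : ∃ e : ℤ, v φ = exp e := ⟨_, (exp_log (v.ne_zero_iff.mpr hφ)).symm⟩
  obtain ⟨n, hn⟩ : ∃ n : ℤ, v c = exp n := ⟨_, (exp_log (v.ne_zero_iff.mpr hc)).symm⟩
  have he0 : e ≠ 0 := by
    rintro rfl
    exact hφ1 he
  set w := c ^ e * φ ^ (-n) with hw
  have hvw : v w = 1 := by
    rw [hw, map_mul, map_zpow₀, map_zpow₀, he, hn, ← exp_zsmul, ← exp_zsmul, ← exp_add,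
      exp_eq_one, smul_eq_mul, smul_eq_mul]
    ring
  have hDw : v (D w) = v (D c / c) := by
    have h1 : v (D w) = v (D w / w) := by rw [map_div₀, hvw, div_one]
    have h2 : v ((e : L) * (D c / c)) = v (D c / c) := by
      rw [map_mul, valuation_intCast_eq_one v hK he0, one_mul]
    have h3 : v (((-n : ℤ) : L) * (D φ / φ)) ≤ v (D φ / φ) := by
      rcases eq_or_ne n 0 with rfl | hn0
      · simp
      · rw [map_mul, valuation_intCast_eq_one v hK (neg_ne_zero.mpr hn0), one_mul]
    rw [h1, hw, D.zpow_mul_zpow_div hc hφ, Valuation.map_add_eq_of_lt_left, h2]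
    rw [h2]
    exact h3.trans_lt hlt
  obtain ⟨h, hh1, hh2⟩ := hres w hvw
  set c' := Polynomial.aeval w h with hc'
  have hDc' : v (D c') = v (D c / c) := by
    rw [hc', Derivation.map_aeval, smul_eq_mul, map_mul, hh2, one_mul, hDw]
  have hpos : 0 < v (D c / c) := zero_le.trans_lt hlt
  have hc'0 : c' ≠ 0 := by
    intro h0
    rw [h0, map_zero, map_zero] at hDc'
    exact hpos.ne hDc'
  refine ⟨c', hc'0, ?_⟩
  have h4 : 0 < v c' := zero_lt_iff.mpr (v.ne_zero_iff.mpr hc'0)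
  rw [map_div₀ v (D c') c', hDc', le_div_iff₀ h4]
  calc exp (1 : ℤ) * v (D c / c) * v c' ≤ exp (1 : ℤ) * v (D c / c) * exp (-1 : ℤ) := by
        gcongr
        exact le_exp_neg_one_of_lt_one hh1
    _ = v (D c / c) := by
        rw [mul_right_comm, ← exp_add]
        simp

open WithZero in
/-- For a bounded derivation, the value of a logarithmic derivative is at most that of any element
of nontrivial value: otherwise `exists_logDeriv_exp_mul_le` would produce logarithmic derivatives
of unbounded value. -/
theorem logDeriv_le_of_valuation_ne_one (hK : ∀ a : K, a ≠ 0 → v (algebraMap K L a) = 1)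
    (hres : ∀ u : L, v u = 1 → ∃ h : Polynomial K,
      v (Polynomial.aeval u h) < 1 ∧ v (Polynomial.aeval u h.derivative) = 1)
    (hbdd : ∃ M, ∀ c, v (D c) ≤ M * v c)
    {φ c : L} (hφ : φ ≠ 0) (hφ1 : v φ ≠ 1) (hc : c ≠ 0) :
    v (D c / c) ≤ v (D φ / φ) := by
  by_contra! hlt
  have key : ∀ n : ℕ, ∃ c' : L, c' ≠ 0 ∧ exp (n : ℤ) * v (D c / c) ≤ v (D c' / c') := by
    intro n
    induction n with
    | zero => exact ⟨c, hc, by simp⟩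
    | succ n ih =>
      obtain ⟨c', hc', hle⟩ := ih
      have h1 : v (D c / c) ≤ exp (n : ℤ) * v (D c / c) := by
        refine le_mul_of_one_le_left' ?_
        rw [← exp_zero, exp_le_exp]
        positivity
      obtain ⟨c'', hc'', hle'⟩ := exists_logDeriv_exp_mul_le v D hK hres hφ hφ1 hc'
        (hlt.trans_le (h1.trans hle))
      refine ⟨c'', hc'', le_trans ?_ hle'⟩
      rw [Nat.cast_succ, add_comm, exp_add, mul_assoc]
      gcongr
  obtain ⟨M, hM⟩ := hbdd
  have hM' : ∀ c' : L, c' ≠ 0 → v (D c' / c') ≤ M := by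
    intro c' hc'
    rw [map_div₀, div_le_iff₀ (zero_lt_iff.mpr (v.ne_zero_iff.mpr hc'))]
    exact hM c'
  have hpos : 0 < v (D c / c) := zero_le.trans_lt hlt
  have hMpos : 0 < M := hpos.trans_le (hM' c hc)
  obtain ⟨r, hr⟩ : ∃ r : ℤ, v (D c / c) = exp r := ⟨_, (exp_log hpos.ne').symm⟩
  obtain ⟨m, rfl⟩ : ∃ m : ℤ, M = exp m := ⟨_, (exp_log hMpos.ne').symm⟩
  obtain ⟨c', hc', hle⟩ := key (m - r + 1).toNat
  have := hle.trans (hM' c' hc')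
  rw [hr, ← exp_add, exp_le_exp] at this
  omega

theorem logDeriv_eq_of_valuation_ne_one (hK : ∀ a : K, a ≠ 0 → v (algebraMap K L a) = 1)
    (hres : ∀ u : L, v u = 1 → ∃ h : Polynomial K,
      v (Polynomial.aeval u h) < 1 ∧ v (Polynomial.aeval u h.derivative) = 1)
    (hbdd : ∃ M, ∀ c, v (D c) ≤ M * v c)
    {φ c : L} (hφ : φ ≠ 0) (hφ1 : v φ ≠ 1) (hc : c ≠ 0) (hc1 : v c ≠ 1) :
    v (D c / c) = v (D φ / φ) :=
  le_antisymm (logDeriv_le_of_valuation_ne_one v D hK hres hbdd hφ hφ1 hc)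
    (logDeriv_le_of_valuation_ne_one v D hK hres hbdd hc hc1 hφ)

/-- The value of a nonzero logarithmic derivative `D φ / φ`, where `v φ ≠ 1`, is not the value of
any derivative. In terms of residues: `D` has no antiderivative of a differential with a simple
pole. -/
theorem valuation_apply_ne_logDeriv (hK : ∀ a : K, a ≠ 0 → v (algebraMap K L a) = 1)
    (hres : ∀ u : L, v u = 1 → ∃ h : Polynomial K,
      v (Polynomial.aeval u h) < 1 ∧ v (Polynomial.aeval u h.derivative) = 1)
    (hbdd : ∃ M, ∀ c, v (D c) ≤ M * v c)
    {φ : L} (hφ : φ ≠ 0) (hφ1 : v φ ≠ 1) (hDφ : D φ ≠ 0) (c : L) :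
    v (D c) ≠ v (D φ / φ) := by
  have hpos : 0 < v (D φ / φ) := zero_lt_iff.mpr (v.ne_zero_iff.mpr (div_ne_zero hDφ hφ))
  intro heq
  have hc : c ≠ 0 := by
    rintro rfl
    rw [map_zero, map_zero] at heq
    exact hpos.ne heq
  by_cases hc1 : v c = 1
  · obtain ⟨h, hh1, hh2⟩ := hres c hc1
    have hD : v (D (Polynomial.aeval c h)) = v (D φ / φ) := by
      rw [Derivation.map_aeval, smul_eq_mul, map_mul, hh2, one_mul, heq]
    have h0 : Polynomial.aeval c h ≠ 0 := by
      intro h0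
      rw [h0, map_zero, map_zero] at hD
      exact hpos.ne hD
    have h1 := logDeriv_le_of_valuation_ne_one v D hK hres hbdd hφ hφ1 h0
    rw [map_div₀ v (D (Polynomial.aeval c h)), hD,
      div_le_iff₀ (zero_lt_iff.mpr (v.ne_zero_iff.mpr h0))] at h1
    exact absurd h1 (not_le.mpr (mul_lt_of_lt_one_right hpos hh1))
  · have h1 := logDeriv_eq_of_valuation_ne_one v D hK hres hbdd hφ hφ1 hc hc1
    rw [map_div₀ v (D c), heq, div_eq_iff (v.ne_zero_iff.mpr hc)] at h1
    exact hc1 (mul_left_cancel₀ hpos.ne' (h1.symm.trans (mul_one _).symm))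

/-- If the residue field of `v` is algebraic over the constants `K`, in the sense that each unit
`u` is killed modulo the maximal ideal by a nonzero polynomial over `K`, then that polynomial may be
taken separable at `u`. -/
theorem exists_separable_residue_polynomial
    (hK : ∀ a : K, a ≠ 0 → v (algebraMap K L a) = 1) {u : L} (hu : v u = 1)
    (h : ∃ h : Polynomial K, h ≠ 0 ∧ v (Polynomial.aeval u h) < 1) :
    ∃ h : Polynomial K,
      v (Polynomial.aeval u h) < 1 ∧ v (Polynomial.aeval u h.derivative) = 1 := by
  classical
  have hle : ∀ p : Polynomial K, v (Polynomial.aeval u p) ≤ 1 := by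
    intro p
    rw [Polynomial.aeval_eq_sum_range]
    refine v.map_sum_le fun i _ => ?_
    rw [Algebra.smul_def, map_mul, map_pow, hu, one_pow, mul_one]
    rcases eq_or_ne (p.coeff i) 0 with h0 | h0
    · simp [h0]
    · exact (hK _ h0).le
  have hex : ∃ d : ℕ, ∃ h : Polynomial K, h ≠ 0 ∧ v (Polynomial.aeval u h) < 1 ∧
      h.natDegree = d := by
    obtain ⟨h, h1, h2⟩ := h
    exact ⟨_, h, h1, h2, rfl⟩
  obtain ⟨h, h0, h1, hd⟩ := Nat.find_spec hex
  refine ⟨h, h1, le_antisymm (hle _) (not_lt.mp fun hlt => ?_)⟩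
  have hdeg : 0 < h.natDegree := by
    rw [Nat.pos_iff_ne_zero]
    intro hz
    rw [Polynomial.eq_C_of_natDegree_eq_zero hz, Polynomial.aeval_C, hK] at h1
    · exact lt_irrefl _ h1
    · intro hc
      apply h0
      rw [Polynomial.eq_C_of_natDegree_eq_zero hz, hc, map_zero]
  have hder : h.derivative ≠ 0 := fun hz =>
    hdeg.ne' (Polynomial.derivative_eq_zero.mp hz)
  refine Nat.find_min hex (m := h.derivative.natDegree) ?_ ⟨_, hder, hlt, rfl⟩
  rw [← hd]
  exact Polynomial.natDegree_derivative_lt hdeg.ne'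

end

/-! ### Function fields of curves -/

theorem Valuation.le_one_of_isIntegral {R L Γ : Type*} [CommRing R] [Field L] [Algebra R L]
    [LinearOrderedCommGroupWithZero Γ] (v : Valuation L Γ)
    (hR : ∀ r : R, v (algebraMap R L r) ≤ 1) {x : L} (hx : IsIntegral R x) : v x ≤ 1 := by
  obtain ⟨p, hp, hpx⟩ := hx
  have hint : IsIntegral v.integer x :=
    ⟨p.map ((algebraMap R L).codRestrict v.integer hR), hp.map _, by
      rw [Polynomial.eval₂_map]; exact hpx⟩
  exact (Valuation.integer.integers v).mem_of_integral hint

theorem Algebra.EssFiniteType.finite_of_isAlgebraic (F L : Type*) [Field F] [Field L] [Algebra F L]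
    [Algebra.EssFiniteType F L] [Algebra.IsAlgebraic F L] : FiniteDimensional F L := by
  obtain ⟨S, hS⟩ := IntermediateField.fg_top F L
  have h1 : FiniteDimensional F (IntermediateField.adjoin F (S : Set L)) :=
    IntermediateField.finiteDimensional_adjoin fun x _ => Algebra.IsIntegral.isIntegral x
  rw [hS] at h1
  exact (IntermediateField.topEquiv (F := F) (E := L)).toLinearEquiv.finiteDimensional

section

open scoped Polynomial

variable (K L : Type*) [Field K] [Field L] [Algebra K L] [Algebra K[X] L] [IsScalarTower K K[X] L]
  [FaithfulSMul K[X] L]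

omit [FaithfulSMul K[X] L] in
theorem algebraMap_eq_aeval_algebraMap_X (p : K[X]) :
    algebraMap K[X] L p = Polynomial.aeval (algebraMap K[X] L Polynomial.X) p := by
  rw [Polynomial.aeval_algebraMap_apply, Polynomial.aeval_X_left_apply]

theorem isAlgebraic_polynomial_of_trdeg_eq_one (h : Algebra.trdeg K L = 1) :
    Algebra.IsAlgebraic K[X] L := by
  have h1 := lift_trdeg_add_eq K K[X] L
  rw [Polynomial.trdeg_of_isDomain, h, Cardinal.lift_one, Cardinal.lift_one] at h1
  rw [← trdeg_eq_zero_iff, ← Cardinal.lift_eq_zero]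
  refine Cardinal.eq_of_add_eq_add_left (a := 1) ?_ Cardinal.one_lt_aleph0
  rw [h1, add_zero]

/-- The integral closure of `K[X]` in a function field of one variable in which `X` is a separating
element is the coordinate ring of a normal affine curve, finite over the affine line. -/
theorem integralClosure_polynomial_isDedekindDomain [CharZero K] [Algebra.EssFiniteType K L]
    [Algebra.IsAlgebraic K[X] L] :
    IsDedekindDomain (integralClosure K[X] L) ∧ IsFractionRing (integralClosure K[X] L) L ∧
      Module.Finite K[X] (integralClosure K[X] L) := by
  let := FractionRing.liftAlgebra K[X] L
  have : IsScalarTower K (FractionRing K[X]) L := IsScalarTower.of_algebraMap_eq fun x => by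
    rw [IsScalarTower.algebraMap_apply K K[X] L, IsScalarTower.algebraMap_apply K K[X]
      (FractionRing K[X]), ← IsScalarTower.algebraMap_apply K[X] (FractionRing K[X]) L]
  have : Algebra.EssFiniteType (FractionRing K[X]) L :=
    Algebra.EssFiniteType.of_comp K (FractionRing K[X]) L
  have : Algebra.IsAlgebraic (FractionRing K[X]) L :=
    (IsFractionRing.comap_isAlgebraic_iff (A := K[X])).mp inferInstance
  have := Algebra.EssFiniteType.finite_of_isAlgebraic (FractionRing K[X]) L
  have : CharZero (FractionRing K[X]) :=
    charZero_of_injective_algebraMap (algebraMap K (FractionRing K[X])).injective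
  exact ⟨integralClosure.isDedekindDomain K[X] (FractionRing K[X]) L,
    integralClosure.isFractionRing_of_finite_extension (FractionRing K[X]) L,
    IsIntegralClosure.finite K[X] (FractionRing K[X]) L _⟩

end

section

open scoped Polynomial

variable {K L : Type*} [Field K] [Field L] [Algebra K L]
  (v : Valuation L (WithZero (Multiplicative ℤ)))

theorem transcendental_of_valuation_lt_one (hK : ∀ a : K, a ≠ 0 → v (algebraMap K L a) = 1)
    {φ : L} (hφ : φ ≠ 0) (hφ1 : v φ < 1) : Transcendental K φ := by
  intro halg
  have hle : v φ⁻¹ ≤ 1 := v.le_one_of_isIntegral (R := K) (fun r => by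
    rcases eq_or_ne r 0 with rfl | hr
    · simp
    · exact (hK r hr).le) halg.inv.isIntegral
  rw [map_inv₀, inv_le_one₀ (zero_lt_iff.mpr (v.ne_zero_iff.mpr hφ))] at hle
  exact absurd hφ1 (not_lt.mpr hle)

/-- In a function field of one variable the residue field of a nontrivial valuation is algebraic
over the constants: reduce a primitive algebraic relation between `u` and an element `φ` of the
maximal ideal. -/
theorem exists_residue_polynomial (htr : Algebra.trdeg K L = 1)
    (hK : ∀ a : K, a ≠ 0 → v (algebraMap K L a) = 1)
    {φ : L} (hφ : φ ≠ 0) (hφ1 : v φ < 1) {u : L} (hu : v u = 1) :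
    ∃ h : K[X], h ≠ 0 ∧ v (Polynomial.aeval u h) < 1 := by
  classical
  have hφt := transcendental_of_valuation_lt_one v hK hφ hφ1
  let : Algebra K[X] L := (Polynomial.aeval φ : K[X] →ₐ[K] L).toAlgebra
  have hmap : ∀ p : K[X], algebraMap K[X] L p = Polynomial.aeval φ p := fun _ => rfl
  have : IsScalarTower K K[X] L := IsScalarTower.of_algebraMap_eq fun x => by
    rw [hmap, Polynomial.algebraMap_apply, Algebra.algebraMap_self_apply, Polynomial.aeval_C]
  have : FaithfulSMul K[X] L := (faithfulSMul_iff_algebraMap_injective K[X] L).mpr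
    (transcendental_iff_injective.mp hφt)
  have := isAlgebraic_polynomial_of_trdeg_eq_one K L htr
  let : NormalizedGCDMonoid K[X] := Classical.choice inferInstance
  have hle : ∀ p : K[X], v (Polynomial.aeval φ p) ≤ 1 := by
    intro p
    rw [Polynomial.aeval_eq_sum_range]
    refine v.map_sum_le fun i _ => ?_
    rw [Algebra.smul_def, map_mul, map_pow]
    refine mul_le_one' ?_ (pow_le_one' hφ1.le _)
    rcases eq_or_ne (p.coeff i) 0 with h0 | h0
    · simp [h0]
    · exact (hK _ h0).le
  obtain ⟨F, hF0, hF⟩ := Algebra.IsAlgebraic.isAlgebraic (R := K[X]) u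
  have hG := Polynomial.aeval_primPart_eq_zero hF0 hF
  have hGp := F.isPrimitive_primPart
  generalize F.primPart = G at hG hGp
  refine ⟨G.map (Polynomial.evalRingHom 0), ?_, ?_⟩
  · intro h0
    refine Polynomial.not_isUnit_X
      (Polynomial.isPrimitive_iff_isUnit_of_C_dvd.mp hGp Polynomial.X ?_)
    rw [Polynomial.C_dvd_iff_dvd_coeff]
    intro i
    rw [Polynomial.X_dvd_iff, Polynomial.coeff_zero_eq_eval_zero, ← Polynomial.coe_evalRingHom,
      ← Polynomial.coeff_map, h0, Polynomial.coeff_zero]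
  · have hsplit : Polynomial.aeval u (G.map (Polynomial.evalRingHom 0)) =
        -(φ * ∑ i ∈ Finset.range (G.natDegree + 1),
          Polynomial.aeval φ (Polynomial.divX (G.coeff i)) * u ^ i) := by
      rw [eq_neg_iff_add_eq_zero, ← hG, Polynomial.aeval_eq_sum_range (p := G),
        Polynomial.aeval_eq_sum_range' (Nat.lt_succ_of_le
          (Polynomial.natDegree_map_le (p := G) (f := Polynomial.evalRingHom 0))),
        Finset.mul_sum, ← Finset.sum_add_distrib]
      refine Finset.sum_congr rfl fun i _ => ?_
      have h1 : Polynomial.aeval φ (G.coeff i) =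
          φ * Polynomial.aeval φ (Polynomial.divX (G.coeff i)) +
            algebraMap K L (Polynomial.eval 0 (G.coeff i)) := by
        conv_lhs => rw [← Polynomial.X_mul_divX_add (G.coeff i)]
        rw [map_add, map_mul, Polynomial.aeval_X, Polynomial.aeval_C,
          Polynomial.coeff_zero_eq_eval_zero]
      rw [Polynomial.coeff_map, Polynomial.coe_evalRingHom, Algebra.smul_def,
        Algebra.smul_def, hmap, h1]
      ring
    rw [hsplit, Valuation.map_neg, map_mul]
    refine mul_lt_one_of_lt_of_le hφ1 (v.map_sum_le fun i _ => ?_)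
    rw [map_mul, map_pow, hu, one_pow, mul_one]
    exact hle _

end

section

open IsDedekindDomain
open scoped Polynomial

variable {K L : Type*} [Field K] [CharZero K] [Field L] [Algebra K L] [Algebra K[X] L]
  [IsScalarTower K K[X] L]
  [IsDedekindDomain (integralClosure K[X] L)] [IsFractionRing (integralClosure K[X] L) L]

omit [CharZero K] in
theorem valuation_algebraMap_eq_one (P : HeightOneSpectrum (integralClosure K[X] L)) {a : K}
    (ha : a ≠ 0) : P.valuation L (algebraMap K L a) = 1 := by
  have h : ∀ b : K, P.valuation L (algebraMap K L b) ≤ 1 := fun b => by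
    rw [IsScalarTower.algebraMap_apply K K[X] L,
      IsScalarTower.algebraMap_apply K[X] (integralClosure K[X] L) L]
    exact P.valuation_le_one _
  refine le_antisymm (h a) ?_
  have := h a⁻¹
  rwa [map_inv₀, map_inv₀, inv_le_one₀ (zero_lt_iff.mpr ?_)] at this
  rw [Valuation.ne_zero_iff]
  exact (_root_.map_ne_zero _).mpr ha

omit [CharZero K] in
/-- A derivation of the function field is bounded for the valuation at a point of the curve, as it
maps the coordinate ring, a finite `K[X]`-module, into a lattice. -/
theorem derivation_bounded [Module.Finite K[X] (integralClosure K[X] L)]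
    (D : Derivation K L L) (P : HeightOneSpectrum (integralClosure K[X] L)) :
    ∃ M, ∀ c, P.valuation L (D c) ≤ M * P.valuation L c := by
  set v := P.valuation L with hv
  have hle : ∀ b : integralClosure K[X] L, v (algebraMap _ L b) ≤ 1 := P.valuation_le_one
  have hle' : ∀ p : K[X], v (algebraMap K[X] L p) ≤ 1 := fun p => by
    rw [IsScalarTower.algebraMap_apply K[X] (integralClosure K[X] L) L]
    exact hle _
  have hB : ∃ M, ∀ b : integralClosure K[X] L, v (D (algebraMap _ L b)) ≤ M := by
    obtain ⟨S, hS⟩ := Module.Finite.fg_top (R := K[X]) (M := integralClosure K[X] L)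
    set τ := algebraMap K[X] L Polynomial.X with hτ
    refine ⟨max (v (D τ)) (S.sup fun b => v (D (algebraMap _ L b))), fun b => ?_⟩
    have hb : b ∈ Submodule.span K[X] (S : Set (integralClosure K[X] L)) := hS ▸ Submodule.mem_top
    induction hb using Submodule.span_induction with
    | mem x hx =>
      exact le_max_of_le_right (Finset.le_sup (f := fun b => v (D (algebraMap _ L b))) hx)
    | zero => simp
    | add x y _ _ hx hy =>
      rw [map_add, map_add]
      exact v.map_add_le hx hy
    | smul p x _ hx =>
      rw [Algebra.smul_def, map_mul, ← IsScalarTower.algebraMap_apply, Derivation.leibniz,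
        smul_eq_mul, smul_eq_mul]
      refine v.map_add_le ?_ ?_
      · rw [map_mul]
        exact (mul_le_of_le_one_left' (hle' p)).trans hx
      · rw [algebraMap_eq_aeval_algebraMap_X, Derivation.map_aeval, smul_eq_mul, map_mul, map_mul,
          ← algebraMap_eq_aeval_algebraMap_X, ← mul_assoc]
        exact le_max_of_le_left (mul_le_of_le_one_left' (mul_le_one' (hle x) (hle' _)))
  obtain ⟨M, hM⟩ := hB
  obtain ⟨t, ht⟩ := P.valuation_exists_uniformizer L
  have ht0 : t ≠ 0 := by
    rintro rfl
    rw [map_zero] at ht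
    exact WithZero.exp_ne_zero ht.symm
  have hone : ∀ n : ℤ, v (n : L) ≤ 1 := fun n => by
    rw [← map_intCast (algebraMap K[X] L)]
    exact hle' _
  refine ⟨max (v (D t / t)) M, fun c => ?_⟩
  rcases eq_or_ne c 0 with rfl | hc
  · simp
  obtain ⟨n, hn⟩ : ∃ n : ℤ, v c = WithZero.exp n :=
    ⟨_, (WithZero.exp_log (v.ne_zero_iff.mpr hc)).symm⟩
  -- `c * t ^ n` is a unit at `P`, hence a quotient of elements of the coordinate ring
  have hu : v (c * t ^ n) = 1 := by
    rw [map_mul, map_zpow₀, hn, ht, ← WithZero.exp_zsmul, ← WithZero.exp_add, WithZero.exp_eq_one]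
    simp
  obtain ⟨b, d, hbd⟩ := P.exists_primeCompl_mul_eq_of_integer (c * t ^ n) hu.le
  have hd : v (algebraMap _ L (d : integralClosure K[X] L)) = 1 :=
    (P.valuation_eq_one_iff_notMem).mpr d.2
  have hb : v (algebraMap _ L b) = 1 := by rw [← hbd, map_mul, hu, hd, one_mul]
  have hb0 : algebraMap _ L b ≠ 0 := v.ne_zero_iff.mp (hb.trans_ne one_ne_zero)
  have hd0 : algebraMap _ L (d : integralClosure K[X] L) ≠ 0 :=
    v.ne_zero_iff.mp (hd.trans_ne one_ne_zero)
  generalize hβ : algebraMap _ L b = β at hb hb0 hbd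
  generalize hδ : algebraMap _ L (d : integralClosure K[X] L) = δ at hd hd0 hbd
  have h1 : D c / c = D β / β - D δ / δ - n * (D t / t) := by
    have hlog : ∀ {x y : L}, x ≠ 0 → y ≠ 0 → D (x * y) / (x * y) = D x / x + D y / y := by
      intro x y hx hy
      simpa using D.zpow_mul_zpow_div hx hy 1 1
    have e1 := D.zpow_mul_zpow_div hc ht0 1 n
    have e2 := hlog (mul_ne_zero hc (zpow_ne_zero n ht0)) hd0
    rw [hbd] at e2
    rw [zpow_one, Int.cast_one, one_mul] at e1
    rw [e2, e1]
    ring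
  have h2 : v (D c / c) ≤ max (v (D t / t)) M := by
    rw [h1]
    refine v.map_sub_le (v.map_sub_le ?_ ?_) ?_
    · rw [map_div₀, hb, div_one, ← hβ]
      exact le_max_of_le_right (hM b)
    · rw [map_div₀, hd, div_one, ← hδ]
      exact le_max_of_le_right (hM d)
    · rw [map_mul]
      exact le_max_of_le_left (mul_le_of_le_one_left' (hone n))
  rwa [map_div₀, div_le_iff₀ (zero_lt_iff.mpr (v.ne_zero_iff.mpr hc))] at h2

end

/-! ### Denominators in Dedekind domains -/

section

open IsDedekindDomain

variable {B L : Type*} [CommRing B] [IsDedekindDomain B] [Field L] [Algebra B L]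
  [IsFractionRing B L]

/-- A fraction `x` over a Dedekind domain satisfies `1 ∈ I + I x` where `I` is its ideal of
denominators, because the fractional ideal generated by `1` and `x` is invertible. -/
theorem exists_add_mul_eq_one_of_denominators (x : L) :
    ∃ i j i' j' : B, algebraMap B L i * x = algebraMap B L i' ∧
      algebraMap B L j * x = algebraMap B L j' ∧ algebraMap B L i + algebraMap B L j * x = 1 := by
  obtain ⟨a, b, hb, rfl⟩ := IsFractionRing.div_surjective (A := B) x
  have hb0 : b ≠ 0 := nonZeroDivisors.ne_zero hb
  have hbL : algebraMap B L b ≠ 0 := by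
    rwa [Ne, FaithfulSMul.algebraMap_eq_zero_iff]
  obtain ⟨J, hJ⟩ := Ideal.dvd_iff_le.mpr
    ((Ideal.span_singleton_le_iff_mem (Ideal.span {a, b})).mpr
      (Ideal.subset_span (Set.mem_insert_of_mem a rfl)))
  have ha : ∀ y ∈ J, ∃ y' : B, algebraMap B L y * (algebraMap B L a / algebraMap B L b) =
      algebraMap B L y' := by
    intro y hy
    have h1 : a * y ∈ Ideal.span {b} := by
      rw [hJ]
      exact Ideal.mul_mem_mul (Ideal.subset_span (Set.mem_insert _ _)) hy
    obtain ⟨y', hy'⟩ := Ideal.mem_span_singleton.mp h1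
    refine ⟨y', ?_⟩
    rw [← mul_div_assoc, div_eq_iff hbL, ← map_mul, ← map_mul, mul_comm y, hy', mul_comm]
  have h1 : b ∈ Ideal.span {a, b} * J := hJ ▸ Ideal.mem_span_singleton_self b
  obtain ⟨p, hp, q, hq, hpq⟩ : ∃ p ∈ J, ∃ q ∈ J, a * p + b * q = b := by
    rw [Ideal.span_insert, Ideal.sup_mul, Submodule.mem_sup] at h1
    obtain ⟨y, hy, z, hz, hyz⟩ := h1
    obtain ⟨p, hp, rfl⟩ := Ideal.mem_span_singleton_mul.mp hy
    obtain ⟨q, hq, rfl⟩ := Ideal.mem_span_singleton_mul.mp hz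
    exact ⟨p, hp, q, hq, hyz⟩
  obtain ⟨p', hp'⟩ := ha p hp
  obtain ⟨q', hq'⟩ := ha q hq
  refine ⟨q, p, q', p', hq', hp', ?_⟩
  have h2 := congrArg (algebraMap B L) hpq
  rw [map_add, map_mul, map_mul] at h2
  rw [← mul_div_assoc, add_div' _ _ _ hbL, div_eq_one_iff_eq hbL]
  linear_combination h2

/-- There are functions with prescribed order at `P` and no pole elsewhere. -/
theorem exists_valuation_eq_and_pow_mul_mem (P : HeightOneSpectrum B)
    (γ : WithZero (Multiplicative ℤ)) :
    ∃ (a : L) (n : ℕ), P.valuation L a = γ ∧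
      ∀ z ∈ P.asIdeal ^ n, ∃ y : B, algebraMap B L z * a = algebraMap B L y := by
  obtain ⟨a₀, ha₀⟩ := P.valuation_surjective L γ
  obtain ⟨b, d, hd, rfl⟩ := IsFractionRing.div_surjective (A := B) a₀
  have hd0 : d ≠ 0 := nonZeroDivisors.ne_zero hd
  have hdL : algebraMap B L d ≠ 0 := by
    rwa [Ne, FaithfulSMul.algebraMap_eq_zero_iff]
  obtain ⟨J, hJ, hPJ⟩ := (FiniteMultiplicity.of_not_isUnit P.irreducible.not_isUnit
    (mt Ideal.span_singleton_eq_bot.mp hd0 : Ideal.span {d} ≠ ⊥)).exists_eq_pow_mul_and_not_dvd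
  obtain ⟨u, huJ, huP⟩ := SetLike.not_le_iff_exists.mp (mt Ideal.dvd_iff_le.mpr hPJ)
  refine ⟨algebraMap B L u * (algebraMap B L b / algebraMap B L d),
    multiplicity P.asIdeal (Ideal.span {d}), ?_, fun z hz => ?_⟩
  · rw [map_mul, ha₀, P.valuation_eq_one_iff_notMem.mpr huP, one_mul]
  · have h1 : z * u ∈ Ideal.span {d} := hJ ▸ Ideal.mul_mem_mul hz huJ
    obtain ⟨y, hy⟩ := Ideal.mem_span_singleton.mp h1
    refine ⟨y * b, ?_⟩
    rw [← mul_assoc, ← map_mul, hy, map_mul, map_mul]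
    field_simp

end

/-! ### Surjective derivations of affine curves -/

section

open IsDedekindDomain
open scoped Polynomial

theorem Derivation.eq_zero_of_isAlgebraic {K L : Type*} [Field K] [CharZero K] [Field L]
    [Algebra K L] (D : Derivation K L L) {z : L} (hz : IsAlgebraic K z) : D z = 0 := by
  have h1 := congrArg D (minpoly.aeval K z)
  rw [Derivation.map_aeval, map_zero, smul_eq_mul] at h1
  exact (mul_eq_zero.mp h1).resolve_left
    ((minpoly.irreducible hz.isIntegral).separable.aeval_derivative_ne_zero (minpoly.aeval K z))

/-- A monic equation bounds the value of its root by that of its coefficients. -/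
theorem Valuation.le_of_monic_eval₂_eq_zero {R L Γ : Type*} [CommRing R] [Field L]
    [LinearOrderedCommGroupWithZero Γ] (v : Valuation L Γ) (f : R →+* L) {p : R[X]} (hp : p.Monic)
    {M : Γ} (hM1 : 1 ≤ M) (hM : ∀ i, v (f (p.coeff i)) ≤ M) {x : L}
    (hx : Polynomial.eval₂ f x p = 0) : v x ≤ M := by
  by_contra! hlt
  have hx1 : 1 ≤ v x := hM1.trans hlt.le
  rw [hp.as_sum, Polynomial.eval₂_add, Polynomial.eval₂_X_pow, Polynomial.eval₂_finsetSum] at hx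
  have h0 : v x ^ p.natDegree ≠ 0 := pow_ne_zero _ (zero_le.trans_lt hlt).ne'
  have h1 : v (∑ i ∈ Finset.range p.natDegree, Polynomial.eval₂ f x
      (Polynomial.C (p.coeff i) * Polynomial.X ^ i)) < v x ^ p.natDegree := by
    refine v.map_sum_lt h0 fun i hi => ?_
    rw [Polynomial.eval₂_mul, Polynomial.eval₂_C, Polynomial.eval₂_X_pow, map_mul, map_pow]
    calc v (f (p.coeff i)) * v x ^ i ≤ M * v x ^ i := by gcongr; exact hM i
      _ < v x * v x ^ i :=
        mul_lt_mul_of_pos_right hlt (pow_pos (zero_le.trans_lt hlt) i)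
      _ = v x ^ (i + 1) := (pow_succ' _ _).symm
      _ ≤ v x ^ p.natDegree := pow_le_pow_right₀ hx1 (Finset.mem_range.mp hi)
  rw [eq_neg_of_add_eq_zero_right hx, Valuation.map_neg, map_pow] at h1
  exact lt_irrefl _ h1

variable {K L : Type*} [Field K] [CharZero K] [Field L] [Algebra K L]

/-- Let a derivation `D` be surjective on an integrally closed ring `A` of functions on a curve, and
let `D s = 1`, where `s ∈ A` is the image of `X`. Then `A` is integral over `K[s]`: if a point over
a finite value of `s` were missing, then all polar parts at that point would occur in `A`, and by
`valuation_apply_ne_logDeriv` a function `a` for which `a ds` has a simple pole has no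
antiderivative. -/
theorem isIntegral_of_surjective_derivation [Algebra K[X] L]
    [IsScalarTower K K[X] L] [FaithfulSMul K[X] L] [Algebra.EssFiniteType K L]
    (htr : Algebra.trdeg K L = 1) (D : Derivation K L L)
    (hD : D (algebraMap K[X] L Polynomial.X) = 1) (A : Subalgebra K L)
    (hA : ∀ z : L, IsIntegral A z → z ∈ A) (hXA : algebraMap K[X] L Polynomial.X ∈ A)
    (hsurj : ∀ a ∈ A, ∃ c ∈ A, D c = a) {x : L} (hx : x ∈ A) : IsIntegral K[X] x := by
  have := isAlgebraic_polynomial_of_trdeg_eq_one K L htr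
  obtain ⟨_, _, _⟩ := integralClosure_polynomial_isDedekindDomain K L
  have hpA : ∀ p : K[X], algebraMap K[X] L p ∈ A := fun p => by
    rw [algebraMap_eq_aeval_algebraMap_X]
    rw [Polynomial.aeval_eq_sum_range]
    exact A.sum_mem fun i _ => A.smul_mem (A.pow_mem hXA i) _
  have hBA : ∀ b : integralClosure K[X] L, algebraMap _ L b ∈ A := by
    rintro ⟨b, p, hp, hpb⟩
    refine hA _ ⟨p.map ((algebraMap K[X] L).codRestrict A hpA), hp.map _, ?_⟩
    rw [Polynomial.eval₂_map]
    exact hpb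
  by_contra hxi
  obtain ⟨P, hP⟩ : ∃ P : HeightOneSpectrum (integralClosure K[X] L), 1 < P.valuation L x := by
    by_contra! h
    obtain ⟨b, hb⟩ := HeightOneSpectrum.mem_integers_of_valuation_le_one L x h
    exact hxi (hb ▸ b.2)
  have hK : ∀ a : K, a ≠ 0 → P.valuation L (algebraMap K L a) = 1 :=
    fun a ha => valuation_algebraMap_eq_one P ha
  -- `P` extends to the unit ideal of `A`
  obtain ⟨i, j, i', j', hi, hj, hij⟩ :=
    exists_add_mul_eq_one_of_denominators (B := integralClosure K[X] L) x
  have hmem : ∀ i i' : integralClosure K[X] L,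
      algebraMap _ L i * x = algebraMap _ L i' → i ∈ P.asIdeal := by
    intro i i' h
    rw [← P.valuation_lt_one_iff_mem (K := L)]
    by_contra! h1
    have h2 := one_lt_mul_of_le_of_lt h1 hP
    rw [← map_mul, h] at h2
    exact absurd (P.valuation_le_one i') (not_le.mpr h2)
  have hiP := hmem _ _ hi
  have hjP := hmem _ _ hj
  have hpow : ∀ (n : ℕ) (w : L), (∀ z ∈ P.asIdeal ^ n, algebraMap _ L z * w ∈ A) → w ∈ A := by
    intro n
    induction n with
    | zero =>
      intro w hw
      simpa using hw 1 (by simp)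
    | succ n ih =>
      intro w hw
      refine ih w fun z hz => ?_
      have h1 := hw (z * i) (pow_succ P.asIdeal n ▸ Ideal.mul_mem_mul hz hiP)
      have h2 := hw (z * j) (pow_succ P.asIdeal n ▸ Ideal.mul_mem_mul hz hjP)
      have h3 : algebraMap _ L z * w =
          algebraMap _ L (z * i) * w + algebraMap _ L (z * j) * w * x := by
        rw [map_mul, map_mul]
        linear_combination (-(algebraMap _ L z) * w) * hij
      rw [h3]
      exact A.add_mem h1 (A.mul_mem h2 hx)
  -- a polynomial in `s` vanishing at `P`
  obtain ⟨p, hpP, hp0⟩ := Submodule.exists_mem_ne_zero_of_ne_bot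
    (Ideal.IsIntegral.comap_ne_bot (R := K[X]) P.ne_bot)
  have hφ0 : algebraMap K[X] L p ≠ 0 := by rwa [Ne, FaithfulSMul.algebraMap_eq_zero_iff]
  have hφ1 : P.valuation L (algebraMap K[X] L p) < 1 := by
    rw [IsScalarTower.algebraMap_apply K[X] (integralClosure K[X] L) L,
      P.valuation_lt_one_iff_mem]
    exact hpP
  have hDφ : D (algebraMap K[X] L p) ≠ 0 := by
    rw [algebraMap_eq_aeval_algebraMap_X, Derivation.map_aeval, hD, smul_eq_mul, mul_one,
      ← algebraMap_eq_aeval_algebraMap_X, Ne, FaithfulSMul.algebraMap_eq_zero_iff,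
      Polynomial.derivative_eq_zero]
    intro hdeg
    rw [Polynomial.eq_C_of_natDegree_eq_zero hdeg] at hφ1 hp0
    rw [← Polynomial.algebraMap_eq, ← IsScalarTower.algebraMap_apply, hK] at hφ1
    · exact lt_irrefl _ hφ1
    · rintro h0
      rw [h0, map_zero] at hp0
      exact hp0 rfl
  obtain ⟨a, n, hav, han⟩ := exists_valuation_eq_and_pow_mul_mem (L := L) P
    (P.valuation L (D (algebraMap K[X] L p) / algebraMap K[X] L p))
  have haA : a ∈ A := hpow n a fun z hz => by
    obtain ⟨y, hy⟩ := han z hz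
    rw [hy]
    exact hBA y
  obtain ⟨c, -, hc⟩ := hsurj a haA
  refine valuation_apply_ne_logDeriv (P.valuation L) D hK (fun u hu =>
    exists_separable_residue_polynomial (P.valuation L) hK hu
      (exists_residue_polynomial (P.valuation L) htr hK hφ0 hφ1 hu))
    (derivation_bounded D P) hφ0 hφ1.ne hDφ c ?_
  rw [hc, hav]

/-- Every transcendental element of a function field has a pole. -/
theorem exists_valuation_gt_one [Algebra.EssFiniteType K L] (htr : Algebra.trdeg K L = 1) {z : L}
    (hz : Transcendental K z) :
    ∃ v : Valuation L (WithZero (Multiplicative ℤ)),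
      (∀ a : K, a ≠ 0 → v (algebraMap K L a) = 1) ∧ 1 < v z ∧
        ∀ D : Derivation K L L, ∃ M, ∀ c, v (D c) ≤ M * v c := by
  have hz0 : z ≠ 0 := by
    rintro rfl
    exact hz isAlgebraic_zero
  have hτ : Transcendental K z⁻¹ := fun h => hz (IsAlgebraic.inv_iff.mp h)
  let _ : Algebra K[X] L := (Polynomial.aeval z⁻¹ : K[X] →ₐ[K] L).toAlgebra
  have hmap : ∀ p : K[X], algebraMap K[X] L p = Polynomial.aeval z⁻¹ p := fun _ => rfl
  have : IsScalarTower K K[X] L := IsScalarTower.of_algebraMap_eq fun x => by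
    rw [hmap, Polynomial.algebraMap_apply, Algebra.algebraMap_self_apply, Polynomial.aeval_C]
  have : FaithfulSMul K[X] L := (faithfulSMul_iff_algebraMap_injective K[X] L).mpr
    (transcendental_iff_injective.mp hτ)
  have := isAlgebraic_polynomial_of_trdeg_eq_one K L htr
  obtain ⟨_, _, _⟩ := integralClosure_polynomial_isDedekindDomain K L
  obtain ⟨P, hP⟩ : ∃ P : HeightOneSpectrum (integralClosure K[X] L), 1 < P.valuation L z := by
    by_contra! h
    obtain ⟨b, hb⟩ := HeightOneSpectrum.mem_integers_of_valuation_le_one L z h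
    have h1 : IsUnit (algebraMap K[X] (integralClosure K[X] L) Polynomial.X) := by
      refine IsUnit.of_mul_eq_one b (FaithfulSMul.algebraMap_injective _ L ?_)
      rw [map_mul, ← IsScalarTower.algebraMap_apply, hmap, Polynomial.aeval_X, map_one]
      exact (congrArg (z⁻¹ * ·) hb).trans (inv_mul_cancel₀ hz0)
    have : FaithfulSMul K[X] (integralClosure K[X] L) := inferInstance
    exact Polynomial.not_isUnit_X (isUnit_of_map_unit _ _ h1)
  exact ⟨P.valuation L, fun a ha => valuation_algebraMap_eq_one P ha, hP,
    fun D => derivation_bounded D P⟩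

/-- If `z` is integral over `K[s]`, where `D s = 1`, then the derivatives of `z` have eventually no
pole at all, as `D` lowers the order of a pole by at least that of `s`. -/
theorem iterate_derivation_eq_zero_of_isIntegral [Algebra K[X] L]
    [IsScalarTower K K[X] L] [Algebra.EssFiniteType K L]
    (htr : Algebra.trdeg K L = 1) (D : Derivation K L L)
    (hD : D (algebraMap K[X] L Polynomial.X) = 1) (A : Subalgebra K L)
    (hDA : ∀ a ∈ A, D a ∈ A) (hA : ∀ a ∈ A, IsIntegral K[X] a) {x : L} (hx : x ∈ A) :
    ∃ n : ℕ, D^[n] x = 0 := by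
  have hDn : ∀ n : ℕ, D^[n] x ∈ A := fun n => by
    induction n with
    | zero => exact hx
    | succ n ih =>
      rw [Function.iterate_succ_apply']
      exact hDA _ ih
  obtain ⟨p, hp, hpx⟩ := hA x hx
  set N := p.support.sup fun i => (p.coeff i).natDegree with hN
  refine ⟨N + 1, ?_⟩
  rw [Function.iterate_succ_apply']
  refine D.eq_zero_of_isAlgebraic ?_
  by_contra hz
  obtain ⟨v, hK, hvz, hbdd⟩ := exists_valuation_gt_one htr hz
  set s := algebraMap K[X] L Polynomial.X with hs
  have hK' : ∀ a : K, v (algebraMap K L a) ≤ 1 := fun a => by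
    rcases eq_or_ne a 0 with rfl | ha
    · simp
    · exact (hK a ha).le
  have hpoly : ∀ q : K[X], v (algebraMap K[X] L q) ≤ (max 1 (v s)) ^ q.natDegree := by
    intro q
    rw [algebraMap_eq_aeval_algebraMap_X, Polynomial.aeval_eq_sum_range]
    refine v.map_sum_le fun i hi => ?_
    rw [Algebra.smul_def, map_mul, map_pow]
    calc v (algebraMap K L (q.coeff i)) * v s ^ i ≤ 1 * (max 1 (v s)) ^ i :=
          mul_le_mul' (hK' _) (pow_le_pow_left₀ zero_le (le_max_right _ _) _)
      _ = (max 1 (v s)) ^ i := one_mul _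
      _ ≤ (max 1 (v s)) ^ q.natDegree :=
          pow_le_pow_right₀ (le_max_left _ _) (Nat.lt_succ_iff.mp (Finset.mem_range.mp hi))
  have hvs : 1 < v s := by
    by_contra! h
    refine absurd hvz (not_lt.mpr (v.le_one_of_isIntegral (fun q => ?_) (hA _ (hDn N))))
    simpa [max_eq_left h] using hpoly q
  rw [max_eq_right hvs.le] at hpoly
  have hvs0 : 0 < v s := zero_lt_one.trans hvs
  have hs0 : s ≠ 0 := v.ne_zero_iff.mp hvs0.ne'
  have hvx : v x ≤ v s ^ N := by
    refine v.le_of_monic_eval₂_eq_zero _ hp (one_le_pow_of_one_le' hvs.le N) (fun i => ?_) hpx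
    refine (hpoly _).trans (pow_le_pow_right₀ hvs.le ?_)
    by_cases hi : i ∈ p.support
    · exact Finset.le_sup (f := fun i => (p.coeff i).natDegree) hi
    · rw [Polynomial.notMem_support_iff.mp hi, Polynomial.natDegree_zero]
      exact Nat.zero_le _
  have hres : ∀ u : L, v u = 1 → ∃ h : K[X],
      v (Polynomial.aeval u h) < 1 ∧ v (Polynomial.aeval u h.derivative) = 1 := fun u hu =>
    exists_separable_residue_polynomial v hK hu
      (exists_residue_polynomial v htr hK (inv_ne_zero hs0)
        (by rw [map_inv₀]; exact inv_lt_one_of_one_lt₀ hvs) hu)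
  have hstep : ∀ c : L, v (D c) * v s ≤ v c := by
    intro c
    rcases eq_or_ne c 0 with rfl | hc
    · simp
    have h1 := logDeriv_le_of_valuation_ne_one v D hK hres (hbdd D) hs0 hvs.ne' hc
    rw [hD, map_div₀, map_div₀, map_one, div_le_div_iff₀
      (zero_lt_iff.mpr (v.ne_zero_iff.mpr hc)) hvs0, one_mul] at h1
    exact h1
  have hiter : ∀ n : ℕ, v (D^[n] x) * v s ^ n ≤ v x := by
    intro n
    induction n with
    | zero => simp
    | succ n ih =>
      refine le_trans ?_ ih
      rw [Function.iterate_succ_apply', pow_succ', ← mul_assoc]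
      gcongr
      exact hstep _
  have h1 := (hiter N).trans hvx
  exact absurd hvz (not_lt.mpr (le_of_mul_le_mul_right (h1.trans (one_mul _).ge)
    (pow_pos hvs0 N)))

/-- A surjective derivation `D` of a normal affine curve over a field of characteristic zero with
`D s = 1` is locally nilpotent. -/
theorem locallyNilpotent_of_surjective_derivation [Algebra.EssFiniteType K L]
    (htr : Algebra.trdeg K L = 1) (D : Derivation K L L) (A : Subalgebra K L)
    (hA : ∀ z : L, IsIntegral A z → z ∈ A) {s : L} (hs : s ∈ A) (hDs : D s = 1)
    (hDA : ∀ a ∈ A, D a ∈ A) (hsurj : ∀ a ∈ A, ∃ c ∈ A, D c = a) {x : L} (hx : x ∈ A) :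
    ∃ n : ℕ, D^[n] x = 0 := by
  have hst : Transcendental K s := fun h => by
    rw [D.eq_zero_of_isAlgebraic h] at hDs
    exact zero_ne_one hDs
  let _ : Algebra K[X] L := (Polynomial.aeval s : K[X] →ₐ[K] L).toAlgebra
  have hmap : ∀ p : K[X], algebraMap K[X] L p = Polynomial.aeval s p := fun _ => rfl
  have hX : algebraMap K[X] L Polynomial.X = s := by rw [hmap, Polynomial.aeval_X]
  have : IsScalarTower K K[X] L := IsScalarTower.of_algebraMap_eq fun x => by
    rw [hmap, Polynomial.algebraMap_apply, Algebra.algebraMap_self_apply, Polynomial.aeval_C]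
  have : FaithfulSMul K[X] L := (faithfulSMul_iff_algebraMap_injective K[X] L).mpr
    (transcendental_iff_injective.mp hst)
  exact iterate_derivation_eq_zero_of_isIntegral htr D (hX.symm ▸ hDs) A hDA (fun a ha =>
    isIntegral_of_surjective_derivation htr D (hX.symm ▸ hDs) A hA (hX.symm ▸ hs) hsurj ha) hx

end

/-! ### Derivations of the polynomial ring in two variables -/

section

variable {k : Type*} [Field k]

/-- The antiderivative of a polynomial with respect to the variable `X i`, normalized to be
divisible by `X i`. -/
noncomputable def MvPolynomial.antiderivative {σ : Type*} (i : σ) :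
    MvPolynomial σ k →ₗ[k] MvPolynomial σ k :=
  (basisMonomials σ k).constr k fun m => monomial (m + Finsupp.single i 1) ((m i + 1 : k)⁻¹)

theorem MvPolynomial.antiderivative_monomial {σ : Type*} (i : σ) (m : σ →₀ ℕ) (a : k) :
    antiderivative i (monomial m a) = monomial (m + Finsupp.single i 1) (a * (m i + 1 : k)⁻¹) := by
  have h1 : monomial m a = a • basisMonomials σ k m := by
    rw [coe_basisMonomials, smul_monomial, smul_eq_mul, mul_one]
  rw [h1, map_smul, antiderivative, Module.Basis.constr_basis, smul_monomial, smul_eq_mul]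

theorem MvPolynomial.pderiv_antiderivative [CharZero k] {σ : Type*} (i : σ)
    (p : MvPolynomial σ k) : pderiv i (antiderivative i p) = p := by
  induction p using MvPolynomial.induction_on' with
  | monomial m a =>
    rw [antiderivative_monomial, pderiv_monomial, add_tsub_cancel_right]
    congr 1
    rw [Finsupp.add_apply, Finsupp.single_eq_same, Nat.cast_add, Nat.cast_one,
      inv_mul_cancel_right₀]
    exact Nat.cast_add_one_ne_zero (m i)
  | add p q hp hq => rw [map_add, map_add, hp, hq]

theorem MvPolynomial.pderiv_antiderivative_of_ne {σ : Type*} {i j : σ} (hij : j ≠ i)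
    (p : MvPolynomial σ k) :
    pderiv j (antiderivative i p) = antiderivative i (pderiv j p) := by
  induction p using MvPolynomial.induction_on' with
  | monomial m a =>
    rw [antiderivative_monomial, pderiv_monomial, pderiv_monomial, antiderivative_monomial]
    rcases Nat.eq_zero_or_pos (m j) with h0 | hpos
    · simp [Finsupp.single_eq_of_ne hij, h0]
    · have hm : m + Finsupp.single i 1 - Finsupp.single j 1 =
          m - Finsupp.single j 1 + Finsupp.single i 1 :=
        (tsub_add_eq_add_tsub (Finsupp.single_le_iff.mpr hpos)).symm
      rw [hm]
      congr 1
      simp [Finsupp.single_eq_of_ne hij, Finsupp.single_eq_of_ne hij.symm]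
      ring
  | add p q hp hq => simp only [map_add, hp, hq]

theorem MvPolynomial.eq_C_of_pderiv_eq_zero [CharZero k] {σ : Type*} {p : MvPolynomial σ k}
    (hp : ∀ i, pderiv i p = 0) : ∃ c, p = C c := by
  classical
  refine ⟨coeff 0 p, MvPolynomial.ext _ _ fun m => ?_⟩
  rw [coeff_C]
  split_ifs with h
  · rw [h]
  · obtain ⟨i, hi⟩ := Finsupp.ne_iff.mp (Ne.symm h)
    have h1 := coeff_pderiv (i := i) p (m - Finsupp.single i 1)
    have h2 : m - Finsupp.single i 1 + Finsupp.single i 1 = m :=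
      tsub_add_cancel_of_le (Finsupp.single_le_iff.mpr (Nat.one_le_iff_ne_zero.mpr hi))
    rw [hp, coeff_zero, h2] at h1
    refine (mul_eq_zero.mp h1.symm).resolve_right ?_
    exact Nat.cast_add_one_ne_zero _

theorem Polynomial.exists_derivative_eq [CharZero k] (g : Polynomial k) :
    ∃ G : Polynomial k, Polynomial.derivative G = g := by
  induction g using Polynomial.induction_on' with
  | add p q hp hq =>
    obtain ⟨P, rfl⟩ := hp
    obtain ⟨Q, rfl⟩ := hq
    exact ⟨P + Q, map_add _ _ _⟩
  | monomial n a =>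
    refine ⟨Polynomial.monomial (n + 1) (a * (n + 1 : k)⁻¹), ?_⟩
    rw [Polynomial.derivative_monomial, Nat.cast_add, Nat.cast_one, inv_mul_cancel_right₀,
      Nat.add_sub_cancel]
    exact Nat.cast_add_one_ne_zero n

/-- The Hamiltonian derivation `f_x ∂_y - f_y ∂_x` of `k[x, y]`, which sends `h` to the Jacobian
determinant of `(f, h)`. -/
noncomputable def jacobianDerivation (f : MvPolynomial (Fin 2) k) :
    Derivation k (MvPolynomial (Fin 2) k) (MvPolynomial (Fin 2) k) :=
  pderiv 0 f • pderiv 1 - pderiv 1 f • pderiv 0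

theorem jacobianDerivation_apply (f h : MvPolynomial (Fin 2) k) :
    jacobianDerivation f h = pderiv 0 f * pderiv 1 h - pderiv 1 f * pderiv 0 h := rfl

theorem jacobianDerivation_self (f : MvPolynomial (Fin 2) k) : jacobianDerivation f f = 0 := by
  rw [jacobianDerivation_apply]
  ring

theorem jacobianDerivation_swap (f h : MvPolynomial (Fin 2) k) :
    jacobianDerivation f h = -jacobianDerivation h f := by
  rw [jacobianDerivation_apply, jacobianDerivation_apply]
  ring

theorem det_jacobianMatrix (F : Fin 2 → MvPolynomial (Fin 2) k) :
    (jacobianMatrix F).det = jacobianDerivation (F 0) (F 1) := by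
  rw [Matrix.det_fin_two, jacobianDerivation_apply]
  rfl

theorem pderiv_comm (i j : Fin 2) (f : MvPolynomial (Fin 2) k) :
    pderiv i (pderiv j f) = pderiv j (pderiv i f) := by
  have h : ⁅(pderiv i : Derivation k (MvPolynomial (Fin 2) k) (MvPolynomial (Fin 2) k)),
      (pderiv j : Derivation k (MvPolynomial (Fin 2) k) (MvPolynomial (Fin 2) k))⁆ = 0 := by
    refine derivation_ext fun l => ?_
    rw [Derivation.commutator_apply, pderiv_X, pderiv_X]
    simp only [Pi.single_apply]
    split_ifs <;> simp
  have h1 := DFunLike.congr_fun h f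
  rw [Derivation.commutator_apply] at h1
  exact sub_eq_zero.mp h1

theorem divergence_jacobianDerivation (f : MvPolynomial (Fin 2) k) :
    divergence (jacobianDerivation f) = 0 := by
  have h0 : jacobianDerivation f (X 0) = -pderiv 1 f := by
    rw [jacobianDerivation_apply, pderiv_X_self, pderiv_X_of_ne (by decide)]
    ring
  have h1 : jacobianDerivation f (X 1) = pderiv 0 f := by
    rw [jacobianDerivation_apply, pderiv_X_self, pderiv_X_of_ne (by decide)]
    ring
  rw [divergence, h0, h1, map_neg, pderiv_comm 0 1, neg_add_cancel]

/-- Poincaré lemma in the plane: a divergence-free derivation is Hamiltonian. -/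
theorem exists_eq_jacobianDerivation_of_divergence_eq_zero [CharZero k]
    (D : Derivation k (MvPolynomial (Fin 2) k) (MvPolynomial (Fin 2) k))
    (hD : divergence D = 0) : ∃ f, D = jacobianDerivation f := by
  set p := D (X 0) with hp
  set q := D (X 1) with hq
  set u := antiderivative 1 (-p) with hu
  have hu1 : pderiv 1 u = -p := pderiv_antiderivative _ _
  have hr : pderiv 1 (q - pderiv 0 u) = 0 := by
    rw [map_sub, pderiv_comm 1 0, hu1, map_neg, sub_neg_eq_add, add_comm]
    exact hD
  set f := u + antiderivative 0 (q - pderiv 0 u) with hf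
  have hf1 : pderiv 1 f = -p := by
    rw [hf, map_add, hu1, pderiv_antiderivative_of_ne (by decide), hr, map_zero, add_zero]
  have hf0 : pderiv 0 f = q := by
    rw [hf, map_add, pderiv_antiderivative, add_sub_cancel]
  refine ⟨f, derivation_ext fun i => ?_⟩
  fin_cases i
  · change D (X 0) = jacobianDerivation f (X 0)
    rw [jacobianDerivation_apply, pderiv_X_self, pderiv_X_of_ne (by decide), hf1, ← hp]
    ring
  · change D (X 1) = jacobianDerivation f (X 1)
    rw [jacobianDerivation_apply, pderiv_X_self, pderiv_X_of_ne (by decide), hf0, ← hq]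
    ring

theorem MvPolynomial.derivation_apply_eq_pderiv
    (δ : Derivation k (MvPolynomial (Fin 2) k) (MvPolynomial (Fin 2) k))
    (h : MvPolynomial (Fin 2) k) :
    δ h = pderiv 0 h * δ (X 0) + pderiv 1 h * δ (X 1) := by
  have h1 : δ = δ (X 0) • pderiv 0 + δ (X 1) • pderiv 1 := by
    refine derivation_ext fun i => ?_
    fin_cases i
    · simp
    · simp
  conv_lhs => rw [h1]
  simp only [Derivation.add_apply, Derivation.smul_apply, smul_eq_mul]
  ring

/-- A derivation is determined by its values on a Jacobian pair. -/
theorem derivation_eq_zero_of_jacobian_pair {f s : MvPolynomial (Fin 2) k}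
    (hfs : jacobianDerivation f s = 1)
    (δ : Derivation k (MvPolynomial (Fin 2) k) (MvPolynomial (Fin 2) k))
    (hf : δ f = 0) (hs : δ s = 0) : δ = 0 := by
  rw [MvPolynomial.derivation_apply_eq_pderiv] at hf hs
  rw [jacobianDerivation_apply] at hfs
  refine derivation_ext fun i => ?_
  fin_cases i
  · change δ (X 0) = 0
    linear_combination (-δ (X 0)) * hfs + pderiv 1 s * hf - pderiv 1 f * hs
  · change δ (X 1) = 0
    linear_combination (-δ (X 1)) * hfs + pderiv 0 f * hs - pderiv 0 s * hf

theorem eq_C_of_jacobian_pair [CharZero k] {f s a : MvPolynomial (Fin 2) k}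
    (hfs : jacobianDerivation f s = 1) (hf : jacobianDerivation f a = 0)
    (hs : jacobianDerivation s a = 0) : ∃ c, a = C c := by
  rw [jacobianDerivation_apply] at hfs hf hs
  refine eq_C_of_pderiv_eq_zero fun i => ?_
  fin_cases i
  · change pderiv 0 a = 0
    linear_combination (-pderiv 0 a) * hfs + pderiv 0 s * hf - pderiv 0 f * hs
  · change pderiv 1 a = 0
    linear_combination (-pderiv 1 a) * hfs + pderiv 1 s * hf - pderiv 1 f * hs

theorem jacobianDerivation_comm {f s : MvPolynomial (Fin 2) k}
    (hfs : jacobianDerivation f s = 1) (a : MvPolynomial (Fin 2) k) :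
    jacobianDerivation f (jacobianDerivation s a) =
      jacobianDerivation s (jacobianDerivation f a) := by
  have h := derivation_eq_zero_of_jacobian_pair hfs ⁅jacobianDerivation f, jacobianDerivation s⁆
    (by
      rw [Derivation.commutator_apply, jacobianDerivation_self, jacobianDerivation_swap s f, hfs,
        map_neg, Derivation.map_one_eq_zero, map_zero, neg_zero, sub_zero])
    (by
      rw [Derivation.commutator_apply, jacobianDerivation_self, hfs, map_zero,
        Derivation.map_one_eq_zero, sub_zero])
  have h1 := DFunLike.congr_fun h a
  rw [Derivation.commutator_apply] at h1
  exact sub_eq_zero.mp h1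

theorem jacobianDerivation_bind₁ {f s : MvPolynomial (Fin 2) k}
    (hfs : jacobianDerivation f s = 1) (h : MvPolynomial (Fin 2) k) :
    jacobianDerivation f (bind₁ ![f, s] h) = bind₁ ![f, s] (pderiv 1 h) := by
  induction h using MvPolynomial.induction_on with
  | C a => simp [derivation_C]
  | add p q hp hq => simp only [map_add, hp, hq]
  | mul_X p i hp =>
    rw [map_mul, Derivation.leibniz, hp, Derivation.leibniz, bind₁_X_right, smul_eq_mul,
      smul_eq_mul, smul_eq_mul, smul_eq_mul, map_add, map_mul, map_mul, bind₁_X_right]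
    congr 2
    fin_cases i
    · change jacobianDerivation f f = bind₁ ![f, s] (pderiv 1 (X 0))
      rw [jacobianDerivation_self, pderiv_X_of_ne (by decide), map_zero]
    · change jacobianDerivation f s = bind₁ ![f, s] (pderiv 1 (X 1))
      rw [hfs, pderiv_X_self, map_one]

/-- A polynomial map generating the polynomial ring is invertible, as its components are then
algebraically independent for reasons of transcendence degree. -/
theorem isInvertiblePolynomialMap_of_surjective {F : Fin 2 → MvPolynomial (Fin 2) k}
    (hF : Function.Surjective (bind₁ F)) : IsInvertiblePolynomialMap F := by
  have hinj : Function.Injective (bind₁ F) := by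
    have htop : Algebra.adjoin k (Set.range F) = ⊤ := by
      rw [Algebra.adjoin_range_eq_range_aeval]
      exact (AlgHom.range_eq_top _).mpr hF
    have : Algebra.IsAlgebraic (Algebra.adjoin k (Set.range F)) (MvPolynomial (Fin 2) k) :=
      ⟨fun x => isAlgebraic_algebraMap
        (⟨x, htop ▸ Algebra.mem_top⟩ : Algebra.adjoin k (Set.range F))⟩
    have hb := Algebra.IsAlgebraic.isTranscendenceBasis_of_lift_le_trdeg_of_finite k F (by
      rw [MvPolynomial.trdeg_of_isDomain]
      simp)
    exact hb.1
  choose G hG using fun i => hF (X i)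
  have hFG : ∀ p, bind₁ F (bind₁ G p) = p := fun p => by
    have h : (bind₁ F).comp (bind₁ G) = AlgHom.id k _ := algHom_ext fun i => by
      rw [AlgHom.comp_apply, bind₁_X_right, hG, AlgHom.id_apply]
    exact DFunLike.congr_fun h p
  refine ⟨G, fun i => hinj ?_, hG⟩
  rw [hFG, bind₁_X_right]

theorem surjective_of_jacobianConjectureTwo [CharZero k] (hJC : JacobianConjectureTwo k)
    {f s : MvPolynomial (Fin 2) k} (hfs : jacobianDerivation f s = 1) :
    Function.Surjective (jacobianDerivation f) := by
  obtain ⟨G, -, hG⟩ := hJC ![f, s] ⟨1, one_ne_zero, by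
    rw [det_jacobianMatrix, map_one]; exact hfs⟩
  intro a
  refine ⟨bind₁ ![f, s] (antiderivative 1 (bind₁ G a)), ?_⟩
  rw [jacobianDerivation_bind₁ hfs, pderiv_antiderivative]
  have h : (bind₁ ![f, s]).comp (bind₁ G) = AlgHom.id k _ := algHom_ext fun i => by
    rw [AlgHom.comp_apply, bind₁_X_right, hG, AlgHom.id_apply]
  exact DFunLike.congr_fun h a

/-- If both Hamiltonian derivations of a Jacobian pair are locally nilpotent, every polynomial is
recovered from constants by iterated antiderivatives with respect to the pair. -/
theorem surjective_bind₁_of_locallyNilpotent [CharZero k] {f s : MvPolynomial (Fin 2) k}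
    (hfs : jacobianDerivation f s = 1)
    (hf : ∀ a, ∃ n : ℕ, (jacobianDerivation f)^[n] a = 0)
    (hs : ∀ a, ∃ n : ℕ, (jacobianDerivation s)^[n] a = 0) :
    Function.Surjective (bind₁ ![f, s]) := by
  have hsf : jacobianDerivation s f = -1 := by rw [jacobianDerivation_swap, hfs]
  have hker : ∀ (n : ℕ) (a : MvPolynomial (Fin 2) k), jacobianDerivation f a = 0 →
      (jacobianDerivation s)^[n] a = 0 → ∃ g : Polynomial k, a = Polynomial.aeval f g := by
    intro n
    induction n with
    | zero => exact fun a _ ha => ⟨0, by rw [map_zero]; exact ha⟩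
    | succ n ih =>
      intro a ha han
      obtain ⟨g, hg⟩ := ih (jacobianDerivation s a)
        (by rw [jacobianDerivation_comm hfs, ha, map_zero]) han
      obtain ⟨H, rfl⟩ := Polynomial.exists_derivative_eq g
      obtain ⟨c, hc⟩ := eq_C_of_jacobian_pair (a := a + Polynomial.aeval f H) hfs
        (by rw [map_add, ha, Derivation.map_aeval, jacobianDerivation_self, smul_zero, add_zero])
        (by
          rw [map_add, Derivation.map_aeval, hsf, hg, smul_eq_mul]
          ring)
      refine ⟨Polynomial.C c - H, ?_⟩
      rw [map_sub, Polynomial.aeval_C]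
      exact eq_sub_of_add_eq hc
  have hS : ∀ g : Polynomial k, ∃ h, bind₁ ![f, s] h = Polynomial.aeval f g := fun g =>
    ⟨Polynomial.aeval (X 0) g, by
      rw [← Polynomial.aeval_algHom_apply, bind₁_X_right]
      rfl⟩
  have key : ∀ (n : ℕ) (a : MvPolynomial (Fin 2) k), (jacobianDerivation f)^[n] a = 0 →
      ∃ h, bind₁ ![f, s] h = a := by
    intro n
    induction n with
    | zero => exact fun a ha => ⟨0, by rw [map_zero]; exact ha.symm⟩
    | succ n ih =>
      intro a ha
      obtain ⟨h, hh⟩ := ih _ ha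
      have h0 : jacobianDerivation f (a - bind₁ ![f, s] (antiderivative 1 h)) = 0 := by
        rw [map_sub, jacobianDerivation_bind₁ hfs, pderiv_antiderivative, hh, sub_self]
      obtain ⟨m, hm⟩ := hs (a - bind₁ ![f, s] (antiderivative 1 h))
      obtain ⟨g, hg⟩ := hker m _ h0 hm
      obtain ⟨h', hh'⟩ := hS g
      exact ⟨h' + antiderivative 1 h, by rw [map_add, hh', ← hg, sub_add_cancel]⟩
  intro a
  obtain ⟨n, hn⟩ := hf a
  exact key n a hn

end

/-! ### Local nilpotence of surjective Hamiltonian derivations -/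

universe u

section

open scoped Polynomial TensorProduct

/-- A derivation extends to the field of fractions. -/
theorem Derivation.exists_extension_fractionRing {k R L : Type*} [Field k] [CommRing R] [IsDomain R]
    [Algebra k R] [Field L] [Algebra R L] [IsFractionRing R L] [Algebra k L] [IsScalarTower k R L]
    (D : Derivation k R R) :
    ∃ D' : Derivation k L L, ∀ r, D' (algebraMap R L r) = algebraMap R L (D r) := by
  have := Algebra.FormallyEtale.of_isLocalization (Rₘ := L) (nonZeroDivisors R)
  let e := KaehlerDifferential.tensorKaehlerEquivOfFormallyEtale k R L
  let φ : L ⊗[R] Ω[R⁄k] →ₗ[L] L :=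
    LinearMap.liftBaseChange L ((Algebra.linearMap R L).comp D.liftKaehlerDifferential)
  refine ⟨(φ.comp e.symm.toLinearMap).compDer (KaehlerDifferential.D k L), fun r => ?_⟩
  change φ (e.symm (KaehlerDifferential.D k L (algebraMap R L r))) = _
  rw [KaehlerDifferential.tensorKaehlerEquivOfFormallyEtale_symm_D_algebraMap]
  simp [φ]

/-- A derivation vanishing on a subfield is linear over it. -/
theorem Derivation.exists_extendScalars {k K L : Type*} [Field k] [Field K] [Field L] [Algebra k L]
    [Algebra K L] (D : Derivation k L L) (hD : ∀ c : K, D (algebraMap K L c) = 0) :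
    ∃ D' : Derivation K L L, ∀ x, D' x = D x :=
  ⟨Derivation.mk'
    { toFun := D
      map_add' := map_add D
      map_smul' := fun c x => by
        rw [Algebra.smul_def, Derivation.leibniz, hD, smul_zero, add_zero, RingHom.id_apply,
          smul_eq_mul, Algebra.smul_def] }
    fun a b => D.leibniz a b, fun _ => rfl⟩

/-- The field of rational functions in two variables over `k` has transcendence degree one over the
subfield generated by any transcendental element. -/
theorem trdeg_eq_one_of_isFractionRing_polynomial {k L : Type u} [Field k] [Field L]
    [Algebra (MvPolynomial (Fin 2) k) L] [IsFractionRing (MvPolynomial (Fin 2) k) L] [Algebra k L]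
    [IsScalarTower k (MvPolynomial (Fin 2) k) L] (K : Type u) [Field K] [Algebra k[X] K]
    [IsFractionRing k[X] K] [Algebra k[X] L] [Algebra K L] [IsScalarTower k[X] K L]
    [IsScalarTower k k[X] L] : Algebra.trdeg K L = 1 := by
  have : FaithfulSMul k[X] L := (faithfulSMul_iff_algebraMap_injective _ _).mpr (by
    rw [IsScalarTower.algebraMap_eq k[X] K L]
    exact (algebraMap K L).injective.comp (IsFractionRing.injective k[X] K))
  have : Algebra.IsAlgebraic (MvPolynomial (Fin 2) k) L :=
    IsLocalization.isAlgebraic _ (nonZeroDivisors (MvPolynomial (Fin 2) k))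
  have : Algebra.IsAlgebraic k[X] K := IsLocalization.isAlgebraic _ (nonZeroDivisors k[X])
  have h1 := trdeg_add_eq k (MvPolynomial (Fin 2) k) (A := L)
  have h2 := trdeg_add_eq k k[X] (A := L)
  have h3 := trdeg_add_eq k[X] K (A := L)
  rw [trdeg_eq_zero (R := MvPolynomial (Fin 2) k), MvPolynomial.trdeg_of_isDomain, add_zero,
    Cardinal.mk_fin, Cardinal.lift_natCast] at h1
  rw [trdeg_eq_zero (A := K), zero_add] at h3
  rw [Polynomial.trdeg_of_isDomain, ← h1, ← h3] at h2
  refine Cardinal.eq_of_add_eq_add_left (a := 1) ?_ Cardinal.one_lt_aleph0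
  rw [h2, one_add_one_eq_two, Nat.cast_ofNat]

/-- The functions on the generic fibre of a polynomial `f`: a subalgebra of the field of rational
functions over the subfield `K` of rational functions in `f`. The parameter `f` enters through the
action of `k[X]` on `L`, with `X` acting as `f`. -/
def genericFiber (k R K L : Type*) [Field k] [CommRing R] [Field L] [Algebra R L] [Field K]
    [Algebra k[X] K] [IsFractionRing k[X] K] [Algebra k[X] R] [Algebra k[X] L] [Algebra K L]
    [IsScalarTower k[X] K L] [IsScalarTower k[X] R L] : Subalgebra K L where
  carrier := {z | ∃ c : k[X], c ≠ 0 ∧ ∃ r : R, algebraMap k[X] L c * z = algebraMap R L r}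
  mul_mem' := by
    rintro a b ⟨c, hc, r, hr⟩ ⟨d, hd, t, ht⟩
    refine ⟨c * d, mul_ne_zero hc hd, r * t, ?_⟩
    rw [map_mul, map_mul, ← hr, ← ht]
    ring
  add_mem' := by
    rintro a b ⟨c, hc, r, hr⟩ ⟨d, hd, t, ht⟩
    refine ⟨c * d, mul_ne_zero hc hd, algebraMap k[X] R d * r + algebraMap k[X] R c * t, ?_⟩
    rw [map_add, map_mul, map_mul, map_mul, ← hr, ← ht, ← IsScalarTower.algebraMap_apply,
      ← IsScalarTower.algebraMap_apply]
    ring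
  algebraMap_mem' := by
    intro x
    obtain ⟨a, b, hb, rfl⟩ := IsFractionRing.div_surjective (A := k[X]) x
    refine ⟨b, nonZeroDivisors.ne_zero hb, algebraMap k[X] R a, ?_⟩
    have hb0 : algebraMap k[X] K b ≠ 0 := by
      rw [Ne, FaithfulSMul.algebraMap_eq_zero_iff]
      exact nonZeroDivisors.ne_zero hb
    rw [IsScalarTower.algebraMap_apply k[X] K L, ← map_mul, mul_div_cancel₀ _ hb0,
      ← IsScalarTower.algebraMap_apply, ← IsScalarTower.algebraMap_apply]

section

variable {k R K L : Type*} [Field k] [CommRing R] [Field L] [Algebra R L]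
  [IsFractionRing R L] [Field K]
  [Algebra k[X] K] [IsFractionRing k[X] K] [Algebra k[X] R] [Algebra k[X] L] [Algebra K L]
  [IsScalarTower k[X] K L] [IsScalarTower k[X] R L]

omit [IsFractionRing R L] in
theorem algebraMap_mem_genericFiber (r : R) : algebraMap R L r ∈ genericFiber k R K L :=
  ⟨1, one_ne_zero, r, by rw [map_one, one_mul]⟩

/-- The ring of functions on the generic fibre is a localization, hence integrally closed. -/
theorem mem_genericFiber_of_isIntegral [IsIntegrallyClosed R] {z : L}
    (hz : IsIntegral (genericFiber k R K L) z) : z ∈ genericFiber k R K L := by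
  let A := genericFiber k R K L
  let _ : Algebra R A :=
    ((algebraMap R L).codRestrict A
      (algebraMap_mem_genericFiber (k := k) (K := K))).toAlgebra
  have hmap : ∀ r : R, ((algebraMap R A r : A) : L) = algebraMap R L r := fun _ => rfl
  have : IsScalarTower R A L := IsScalarTower.of_algebraMap_eq fun _ => rfl
  have hne : ∀ c : k[X], c ≠ 0 → algebraMap k[X] L c ≠ 0 := fun c hc => by
    rw [IsScalarTower.algebraMap_apply k[X] K L]
    refine (map_ne_zero _).mpr ?_
    rwa [Ne, FaithfulSMul.algebraMap_eq_zero_iff]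
  have : IsLocalization ((nonZeroDivisors k[X]).map (algebraMap k[X] R)) A := by
    refine ⟨?_, ?_, ?_⟩
    · rintro ⟨_, c, hc, rfl⟩
      have hc0 := hne c (nonZeroDivisors.ne_zero hc)
      refine IsUnit.of_mul_eq_one (⟨(algebraMap k[X] L c)⁻¹, c, nonZeroDivisors.ne_zero hc, 1,
        by rw [mul_inv_cancel₀ hc0, map_one]⟩ : A) (Subtype.ext ?_)
      change algebraMap R L (algebraMap k[X] R c) * (algebraMap k[X] L c)⁻¹ = 1
      rw [← IsScalarTower.algebraMap_apply, mul_inv_cancel₀ hc0]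
    · rintro ⟨z, c, hc, r, hr⟩
      refine ⟨⟨r, algebraMap k[X] R c, c, mem_nonZeroDivisors_of_ne_zero hc, rfl⟩,
        Subtype.ext ?_⟩
      change z * algebraMap R L (algebraMap k[X] R c) = algebraMap R L r
      rw [← IsScalarTower.algebraMap_apply, mul_comm, hr]
    · intro x y hxy
      refine ⟨1, ?_⟩
      rw [IsFractionRing.injective R L (congrArg Subtype.val hxy)]
  obtain ⟨⟨_, c, hc, rfl⟩, hm⟩ := hz.exists_multiple_integral_of_isLocalization
    ((nonZeroDivisors k[X]).map (algebraMap k[X] R)) z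
  obtain ⟨r, hr⟩ := IsIntegrallyClosed.isIntegral_iff.mp hm
  refine ⟨c, nonZeroDivisors.ne_zero hc, r, ?_⟩
  rw [hr, Submonoid.smul_def, Algebra.smul_def, ← IsScalarTower.algebraMap_apply]

end

/-- A surjective Hamiltonian derivation with a slice is locally nilpotent: it acts on the functions
on the generic fibre of the Hamiltonian, a normal affine curve, and there
`locallyNilpotent_of_surjective_derivation` applies. -/
theorem locallyNilpotent_of_surjective_jacobianDerivation {k : Type u} [Field k] [CharZero k]
    {f s : MvPolynomial (Fin 2) k} (hfs : jacobianDerivation f s = 1)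
    (hsurj : Function.Surjective (jacobianDerivation f)) (a : MvPolynomial (Fin 2) k) :
    ∃ n : ℕ, (jacobianDerivation f)^[n] a = 0 := by
  let R := MvPolynomial (Fin 2) k
  let L := FractionRing R
  obtain ⟨D, hD⟩ := (jacobianDerivation f).exists_extension_fractionRing (L := L)
  have hinj : Function.Injective (algebraMap R L) := IsFractionRing.injective R L
  -- `f` is transcendental, as the derivation defined by `s` does not kill it
  have hft : Function.Injective (Polynomial.aeval f : k[X] →ₐ[k] R) := by
    refine (injective_iff_map_eq_zero _).mpr fun p hp => ?_
    induction hn : p.natDegree using Nat.strong_induction_on generalizing p with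
    | _ n ih =>
      have h1 := congrArg (jacobianDerivation s) hp
      rw [Derivation.map_aeval, jacobianDerivation_swap, hfs, map_zero, smul_eq_mul, mul_neg,
        mul_one, neg_eq_zero] at h1
      rcases Nat.eq_zero_or_pos n with rfl | hpos
      · rw [Polynomial.eq_C_of_natDegree_eq_zero hn, Polynomial.aeval_C] at hp
        rw [Polynomial.eq_C_of_natDegree_eq_zero hn,
          (map_eq_zero_iff _ (C_injective (Fin 2) k)).mp hp, map_zero]
      · have h2 := ih _ (hn ▸ Polynomial.natDegree_derivative_lt (hn ▸ hpos.ne')) _ h1 rfl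
        exact absurd (Polynomial.derivative_eq_zero.mp h2) (hn ▸ hpos.ne')
  let _ : Algebra k[X] R := (Polynomial.aeval f : k[X] →ₐ[k] R).toAlgebra
  have hmap : ∀ p : k[X], algebraMap k[X] L p = algebraMap R L (Polynomial.aeval f p) :=
    fun p => IsScalarTower.algebraMap_apply k[X] R L p
  have : IsScalarTower k k[X] L := IsScalarTower.of_algebraMap_eq fun x => by
    rw [hmap, Polynomial.algebraMap_apply, Algebra.algebraMap_self_apply, Polynomial.aeval_C,
      ← IsScalarTower.algebraMap_apply]
  have : FaithfulSMul k[X] L := (faithfulSMul_iff_algebraMap_injective _ _).mpr (hinj.comp hft)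
  let K := FractionRing k[X]
  let _ : Algebra K L := FractionRing.liftAlgebra k[X] L
  have : IsScalarTower k K L := IsScalarTower.of_algebraMap_eq fun x => by
    rw [IsScalarTower.algebraMap_apply k k[X] L, IsScalarTower.algebraMap_apply k k[X] K,
      ← IsScalarTower.algebraMap_apply k[X] K L]
  have : CharZero K := charZero_of_injective_algebraMap (algebraMap k K).injective
  have : Algebra.EssFiniteType R L := Algebra.EssFiniteType.of_isLocalization L (nonZeroDivisors R)
  have : Algebra.EssFiniteType k L := Algebra.EssFiniteType.comp k R L
  have : Algebra.EssFiniteType K L := Algebra.EssFiniteType.of_comp k K L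
  have hDp : ∀ p : k[X], D (algebraMap k[X] L p) = 0 := fun p => by
    rw [hmap, hD, Derivation.map_aeval, jacobianDerivation_self, smul_zero, map_zero]
  have hDK : ∀ c : K, D (algebraMap K L c) = 0 := fun c => by
    obtain ⟨a, b, -, rfl⟩ := IsFractionRing.div_surjective (A := k[X]) c
    rw [map_div₀, ← IsScalarTower.algebraMap_apply, ← IsScalarTower.algebraMap_apply,
      Derivation.leibniz_div, hDp, hDp, smul_zero, smul_zero, sub_zero, smul_zero]
  obtain ⟨D', hD'⟩ := D.exists_extendScalars hDK
  have hDA : ∀ z : L, ∀ c : k[X], D (algebraMap k[X] L c * z) = algebraMap k[X] L c * D z :=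
    fun z c => by rw [Derivation.leibniz, hDp, smul_zero, add_zero, smul_eq_mul]
  obtain ⟨n, hn⟩ := locallyNilpotent_of_surjective_derivation
    (trdeg_eq_one_of_isFractionRing_polynomial (k := k) K) D' (genericFiber k R K L)
    (fun z hz => mem_genericFiber_of_isIntegral hz)
    (s := algebraMap R L s) (algebraMap_mem_genericFiber s)
    (by rw [hD', hD, hfs, map_one])
    (by
      rintro z ⟨c, hc, r, hr⟩
      exact ⟨c, hc, jacobianDerivation f r, by rw [hD', ← hDA, hr, hD]⟩)
    (by
      rintro z ⟨c, hc, r, hr⟩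
      obtain ⟨b, rfl⟩ := hsurj r
      have hc0 : algebraMap k[X] L c ≠ 0 := by rwa [Ne, FaithfulSMul.algebraMap_eq_zero_iff]
      have h1 : algebraMap k[X] L c * (algebraMap R L b / algebraMap k[X] L c) =
          algebraMap R L b := mul_div_cancel₀ _ hc0
      refine ⟨algebraMap R L b / algebraMap k[X] L c, ⟨c, hc, b, h1⟩, ?_⟩
      refine mul_left_cancel₀ hc0 ?_
      rw [hD', ← hDA, h1, hD, hr])
    (algebraMap_mem_genericFiber (k := k) (K := K) a)
  refine ⟨n, hinj ?_⟩
  have h1 : ∀ n : ℕ, D'^[n] (algebraMap R L a) = algebraMap R L ((jacobianDerivation f)^[n] a) := by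
    intro n
    induction n with
    | zero => rfl
    | succ n ih => rw [Function.iterate_succ_apply', Function.iterate_succ_apply', ih, hD', hD]
  rw [map_zero, ← hn, h1]

end

/-! ### Surjective derivations and the Jacobian conjecture -/

/-- A subspace that contains `1` is a Mathieu subspace only if it is the whole algebra. -/
theorem isMathieuSubspace_derivationImage_iff_surjective {k R : Type*} [Field k] [CommRing R]
    [Algebra k R] {D : Derivation k R R} (hD : 1 ∈ derivationImage D) :
    IsMathieuSubspace (derivationImage D) ↔ Function.Surjective D := by
  constructor
  · intro hM b
    obtain ⟨N, hN⟩ := hM 1 (fun m _ => by rwa [one_pow]) b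
    have h1 := hN N le_rfl
    rwa [one_pow, mul_one] at h1
  · exact fun hs a _ b => ⟨0, fun m _ => hs _⟩

theorem jacobianConjectureTwo_of_surjective {k : Type u} [Field k] [CharZero k]
    (h : ∀ f s : MvPolynomial (Fin 2) k, jacobianDerivation f s = 1 →
      Function.Surjective (jacobianDerivation f)) : JacobianConjectureTwo k := by
  rintro F ⟨c, hc, hF⟩
  rw [det_jacobianMatrix] at hF
  set f := F 0 with hf
  set s := C c⁻¹ * F 1 with hs
  have hfs : jacobianDerivation f s = 1 := by
    rw [hs, C_mul', Derivation.map_smul, hF, smul_eq_C_mul, ← C_mul, inv_mul_cancel₀ hc, C_1]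
  have hsf : jacobianDerivation s (-f) = 1 := by
    rw [map_neg, jacobianDerivation_swap, neg_neg, hfs]
  have hsurj := surjective_bind₁_of_locallyNilpotent hfs
    (locallyNilpotent_of_surjective_jacobianDerivation hfs (h _ _ hfs))
    (locallyNilpotent_of_surjective_jacobianDerivation hsf (h _ _ hsf))
  refine isInvertiblePolynomialMap_of_surjective fun a => ?_
  obtain ⟨b, rfl⟩ := hsurj a
  refine ⟨bind₁ ![X 0, C c⁻¹ * X 1] b, ?_⟩
  rw [bind₁_bind₁]
  congr 2
  funext i
  fin_cases i
  · simp [hf]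
  · simp [hs]

theorem theorem4p3 (k : Type*) [Field k] [CharZero k] :
    ((∀ D : Derivation k (MvPolynomial (Fin 2) k) (MvPolynomial (Fin 2) k),
        divergence D = 0 → 1 ∈ derivationImage D → IsMathieuSubspace (derivationImage D)) ↔
      JacobianConjectureTwo k) ∧
    (∀ D : Derivation k (MvPolynomial (Fin 2) k) (MvPolynomial (Fin 2) k),
      divergence D = 0 → 1 ∈ derivationImage D →
        (IsMathieuSubspace (derivationImage D) ↔ Function.Surjective D)) := by
  refine ⟨⟨fun h => ?_, fun h D hdiv hD => ?_⟩, fun D _ hD =>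
    isMathieuSubspace_derivationImage_iff_surjective hD⟩
  · refine jacobianConjectureTwo_of_surjective fun f s hfs => ?_
    have h1 : 1 ∈ derivationImage (jacobianDerivation f) := ⟨s, hfs⟩
    exact (isMathieuSubspace_derivationImage_iff_surjective h1).mp
      (h _ (divergence_jacobianDerivation f) h1)
  · obtain ⟨f, rfl⟩ := exists_eq_jacobianDerivation_of_divergence_eq_zero D hdiv
    obtain ⟨s, hs⟩ := hD
    exact (isMathieuSubspace_derivationImage_iff_surjective ⟨s, hs⟩).mpr
      (surjective_of_jacobianConjectureTwo h hs)
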